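/- Let $G$ be a finite group, and let $F(G)$ denote its Fitting subgroup, i.e. its largest nilpotent normal subgroup. A subgroup $H$ of $G$ is called $F(G)$-subnormal if $H$ is subnormal in the subgroup $\langle H, F(G)\rangle$. A group is called supersoluble if it has a finite series of normal subgroups of the whole group, from the trivial subgroup to the whole group, with cyclic factors. Let $A$, $B$ and $C$ be $F(G)$-subnormal supersoluble subgroups of $G$. If the indices $|G:A|$, $|G:B|$ and $|G:C|$ are pairwise coprime, then $G$ is supersoluble. -/

import Mathlib

/-- A group `G` is supersoluble if it has a finite series
`1 = N 0 ≤ N 1 ≤ ⋯ ≤ N n = G` of subgroups, all of them normal in `G`,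
with cyclic factors `N (i + 1) / N i`. -/
def IsSupersoluble (G : Type*) [Group G] : Prop :=
  ∃ (n : ℕ) (N : ℕ → Subgroup G) (_ : ∀ i, (N i).Normal),
    N 0 = ⊥ ∧ N n = ⊤ ∧
      ∀ i < n, N i ≤ N (i + 1) ∧ IsCyclic (↥(N (i + 1)) ⧸ (N i).subgroupOf (N (i + 1)))

/-- The Fitting subgroup `F(G)`: the subgroup generated by all nilpotent normal subgroups of `G`.
For a finite group it is the largest nilpotent normal subgroup. -/
def fittingSubgroup (G : Type*) [Group G] : Subgroup G :=
  sSup {N : Subgroup G | N.Normal ∧ Group.IsNilpotent ↥N}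

/-- A subgroup `H` of `G` is `R`-subnormal if it is subnormal in `⟨H, R⟩`. -/
def Subgroup.IsRelSubnormal {G : Type*} [Group G] (R H : Subgroup G) : Prop :=
  (H.subgroupOf (H ⊔ R)).IsSubnormal

/-! Write F = F(G). Two reductions come first. A supersoluble F-subnormal subgroup A can be replaced
by AF: climbing the subnormal chain, a supersoluble normal factor times a nilpotent normal factor is
supersoluble (`IsSupersoluble.sup_of_isRelSubnormal`). And G is soluble, without using subnormality
(`Group.isSolvable_of_coprime_index`), so C_G(F) ≤ F.

The core is that F has a G-normal series with cyclic factors when A, B, C all contain F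
(`HasCyclicSeries.of_coprime_index`). Let N ≤ F be minimal normal in G, so N is elementary abelian
for a prime p. In Q = G/C_G(N) the images of A, B, C have p-groups as derived subgroups, while
O_p(Q) = 1. Each prime misses two of the three indices, and a Sylow argument then makes Q abelian.
Hence an element of A acting as a power map on one nontrivial element of N does so on all of N. So A
and likewise B normalise every cyclic subgroup of N, and G = AB. Factor out such a subgroup and
induct.

Finally G' centralises every factor of this series and C_G(F) ≤ F, so G' is nilpotent
(`HasCyclicSeries.isNilpotent_commutator`). Thus G' ≤ F, and the series of F extends freely to G. -/

open Subgroup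
open scoped commutatorElement

/-! ### Series with cyclic factors, and supersolubility -/

/-- `HasCyclicSeries A K` means that `K` is a subgroup of `A` that has a finite series with cyclic
factors, starting from the trivial subgroup, all of whose terms are normalized by `A`. -/
inductive HasCyclicSeries {G : Type*} [Group G] (A : Subgroup G) : Subgroup G → Prop
  | bot : HasCyclicSeries A ⊥
  | step (K : Subgroup G) (g : G) : HasCyclicSeries A K → g ∈ A →
      A ≤ Subgroup.normalizer (K ⊔ Subgroup.zpowers g : Subgroup G) →
      HasCyclicSeries A (K ⊔ Subgroup.zpowers g)

theorem Subgroup.mem_sup_zpowers_iff {G : Type*} [Group G] {K : Subgroup G} {g x : G}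
    (hg : g ∈ normalizer (K : Set G)) :
    x ∈ K ⊔ zpowers g ↔ ∃ k ∈ K, ∃ n : ℤ, k * g ^ n = x := by
  rw [← SetLike.mem_coe, coe_mul_of_right_le_normalizer_left K (zpowers g) (by simpa using hg)]
  simp [Set.mem_mul, mem_zpowers_iff]

theorem Subgroup.mem_sup_zpowers_of_inv_zpow_mul_mem {G : Type*} [Group G] {K : Subgroup G}
    {g x : G} {n : ℤ} (h : (g ^ n)⁻¹ * x ∈ K) : x ∈ K ⊔ zpowers g := by
  rw [sup_comm]
  have : x = g ^ n * ((g ^ n)⁻¹ * x) := by group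
  rw [this]
  exact mul_mem_sup (zpow_mem_zpowers g n) h

namespace HasCyclicSeries

variable {G : Type*} [Group G] {A K : Subgroup G}

theorem le_normalizer (h : HasCyclicSeries A K) : A ≤ normalizer (K : Set G) := by
  cases h with
  | bot => exact le_normalizer_of_normal
  | step K g _ _ h => exact h

theorem normal (h : HasCyclicSeries ⊤ K) : K.Normal :=
  normalizer_eq_top_iff.1 (top_le_iff.1 h.le_normalizer)

theorem step_top (h : HasCyclicSeries ⊤ K) (g : G) (hn : (K ⊔ zpowers g).Normal) :
    HasCyclicSeries ⊤ (K ⊔ zpowers g) :=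
  .step K g h trivial (by rw [normalizer_eq_top])

theorem map {Q : Type*} [Group Q] (f : G →* Q) (h : HasCyclicSeries A K) :
    HasCyclicSeries (A.map f) (K.map f) := by
  induction h with
  | bot => rw [Subgroup.map_bot]; exact .bot
  | step K g _ hg hn ih =>
    have := Subgroup.map_mono (f := f) hn
    have := this.trans (le_normalizer_map f)
    rw [Subgroup.map_sup, MonoidHom.map_zpowers] at this ⊢
    exact .step _ _ ih (mem_map_of_mem f hg) this

theorem comap {Q : Type*} [Group Q] {f : G →* Q} (hf : Function.Surjective f)
    (hk : HasCyclicSeries ⊤ f.ker) {L : Subgroup Q} (h : HasCyclicSeries ⊤ L) :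
    HasCyclicSeries ⊤ (L.comap f) := by
  induction h with
  | bot => exact hk
  | step L q hL _ hn ih =>
    obtain ⟨g, rfl⟩ := hf q
    have hN : (L ⊔ zpowers (f g)).Normal := normalizer_eq_top_iff.1 (top_le_iff.1 hn)
    have e : (L ⊔ zpowers (f g)).comap f = L.comap f ⊔ zpowers g := by
      rw [← MonoidHom.map_zpowers, ← Subgroup.map_comap_eq_self_of_surjective hf L,
        ← Subgroup.map_sup, comap_map_eq_self, Subgroup.map_comap_eq_self_of_surjective hf L]
      exact le_sup_of_le_left (f.ker_le_comap L)
    rw [e]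
    exact ih.step_top g (e ▸ inferInstance)

end HasCyclicSeries

section

variable {G : Type*} [Group G]

theorem Subgroup.exists_eq_sup_zpowers_of_isCyclic {K L : Subgroup G} [K.Normal] (hKL : K ≤ L)
    (hc : IsCyclic (↥L ⧸ K.subgroupOf L)) : ∃ g, L = K ⊔ zpowers g := by
  obtain ⟨q, hq⟩ := hc
  obtain ⟨g, rfl⟩ := QuotientGroup.mk_surjective q
  refine ⟨g, le_antisymm (fun x hx => ?_) (sup_le hKL (by simp))⟩
  obtain ⟨n, hn⟩ := mem_zpowers_iff.1 (hq (QuotientGroup.mk ⟨x, hx⟩))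
  rw [← QuotientGroup.mk_zpow, QuotientGroup.eq, mem_subgroupOf] at hn
  exact mem_sup_zpowers_of_inv_zpow_mul_mem (n := n) (by simpa using hn)

theorem Subgroup.isCyclic_quotient_sup_zpowers {K : Subgroup G} [K.Normal] (g : G) :
    IsCyclic (↥(K ⊔ zpowers g) ⧸ K.subgroupOf (K ⊔ zpowers g)) := by
  have hg : g ∈ K ⊔ zpowers g := mem_sup_right (mem_zpowers g)
  refine ⟨QuotientGroup.mk ⟨g, hg⟩, fun q => ?_⟩
  obtain ⟨⟨x, hx⟩, rfl⟩ := QuotientGroup.mk_surjective q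
  obtain ⟨k, hk, n, rfl⟩ := (mem_sup_zpowers_iff (by rw [normalizer_eq_top]; trivial)).1 hx
  refine mem_zpowers_iff.2 ⟨n, ?_⟩
  rw [← QuotientGroup.mk_zpow, QuotientGroup.eq, mem_subgroupOf]
  have := ‹K.Normal›.conj_mem k hk (g ^ n)⁻¹
  simpa [mul_assoc] using this

theorem Subgroup.isCyclic_quotient_congr {K L K' L' : Subgroup G} [K.Normal] [K'.Normal]
    (hK : K = K') (hL : L = L') (h : IsCyclic (↥L ⧸ K.subgroupOf L)) :
    IsCyclic (↥L' ⧸ K'.subgroupOf L') := by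
  subst hK hL
  exact h

theorem isSupersoluble_iff : IsSupersoluble G ↔ HasCyclicSeries (⊤ : Subgroup G) ⊤ := by
  constructor
  · rintro ⟨n, N, hN, h0, hn, h⟩
    suffices h : ∀ i ≤ n, HasCyclicSeries ⊤ (N i) by
      have := h n le_rfl
      rwa [hn] at this
    intro i
    induction i with
    | zero => intro _; rw [h0]; exact .bot
    | succ i ih =>
      intro hi
      obtain ⟨hle, hc⟩ := h i hi
      have := hN i
      have := hN (i + 1)
      obtain ⟨g, hg⟩ := exists_eq_sup_zpowers_of_isCyclic hle hc
      rw [hg]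
      exact (ih (by omega)).step_top g (hg ▸ inferInstance)
  · suffices ∀ K : Subgroup G, HasCyclicSeries ⊤ K → ∃ (n : ℕ) (N : ℕ → Subgroup G)
        (_ : ∀ i, (N i).Normal), N 0 = ⊥ ∧ N n = K ∧
        ∀ i < n, N i ≤ N (i + 1) ∧ IsCyclic (↥(N (i + 1)) ⧸ (N i).subgroupOf (N (i + 1))) from
      this ⊤
    intro K h
    induction h with
    | bot => exact ⟨0, fun _ => ⊥, fun _ => inferInstance, rfl, rfl, by simp⟩
    | step K g hK _ hn ih =>
      obtain ⟨n, N, hN, h0, rfl, h⟩ := ih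
      have hKg : (N n ⊔ zpowers g).Normal := normalizer_eq_top_iff.1 (top_le_iff.1 hn)
      -- The chain stays constant past `n + 1`, because every term has to be normal, not only those
      -- in the series.
      set N' : ℕ → Subgroup G := fun i => if i ≤ n then N i else N n ⊔ zpowers g with hN'
      have h1 : ∀ i ≤ n, N i = N' i := fun i hi => by simp [hN', hi]
      have h2 : N n ⊔ zpowers g = N' (n + 1) := by simp [hN']
      have hn' : ∀ i, (N' i).Normal := fun i => by
        simp only [hN']
        split_ifs
        · exact hN i
        · exact hKg
      refine ⟨n + 1, N', hn', by rw [← h1 0 n.zero_le, h0], h2.symm, fun i hi => ?_⟩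
      have := hN i
      have := hn' i
      rcases (Nat.lt_succ_iff.1 hi).lt_or_eq with hi | rfl
      · have := h i hi
        exact ⟨h1 i hi.le ▸ h1 (i + 1) hi ▸ this.1,
          isCyclic_quotient_congr (h1 i hi.le) (h1 (i + 1) hi) this.2⟩
      · exact ⟨h1 i le_rfl ▸ h2 ▸ le_sup_left,
          isCyclic_quotient_congr (h1 i le_rfl) h2 (isCyclic_quotient_sup_zpowers g)⟩

theorem IsSupersoluble.of_surjective {Q : Type*} [Group Q] (h : IsSupersoluble G) {f : G →* Q}
    (hf : Function.Surjective f) : IsSupersoluble Q := by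
  rw [isSupersoluble_iff] at h ⊢
  have := h.map f
  rwa [map_top_of_surjective f hf] at this

theorem IsSupersoluble.hasCyclicSeries {A : Subgroup G} (h : IsSupersoluble ↥A) :
    HasCyclicSeries A A := by
  have := (isSupersoluble_iff.1 h).map A.subtype
  rwa [← MonoidHom.range_eq_map, A.range_subtype] at this

theorem IsSupersoluble.map {Q : Type*} [Group Q] {A : Subgroup G} (h : IsSupersoluble ↥A)
    (f : G →* Q) : IsSupersoluble ↥(A.map f) :=
  h.of_surjective (f.subgroupMap_surjective A)

theorem IsSupersoluble.of_quotient (N : Subgroup G) [N.Normal] (hN : HasCyclicSeries ⊤ N)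
    (h : IsSupersoluble (G ⧸ N)) : IsSupersoluble G := by
  rw [isSupersoluble_iff] at h ⊢
  have := HasCyclicSeries.comap (f := QuotientGroup.mk' N) (QuotientGroup.mk'_surjective N)
    (by rwa [QuotientGroup.ker_mk']) h
  rwa [comap_top] at this

theorem HasCyclicSeries.zpowers (g : G) [(zpowers g).Normal] : HasCyclicSeries ⊤ (zpowers g) := by
  have := (HasCyclicSeries.bot (A := (⊤ : Subgroup G))).step_top g
    (by rw [bot_sup_eq]; infer_instance)
  rwa [bot_sup_eq] at this

theorem IsSupersoluble.isSolvable (h : IsSupersoluble G) : Group.IsSolvable G := by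
  rw [isSupersoluble_iff] at h
  suffices ∀ K : Subgroup G, HasCyclicSeries ⊤ K → Group.IsSolvable ↥K by
    have := this _ h
    exact Group.isSolvable_of_surjective (G := (⊤ : Subgroup G)) (f := (⊤ : Subgroup G).subtype)
      (fun x => ⟨⟨x, trivial⟩, rfl⟩)
  intro K h
  induction h with
  | bot => infer_instance
  | step K g hK _ _ ih =>
    have := hK.normal
    have hc := isCyclic_quotient_sup_zpowers (K := K) g
    rw [Group.isSolvable_iff_subgroup_quotient (K.subgroupOf (K ⊔ Subgroup.zpowers g))]
    refine ⟨Group.isSolvable_of_isSolvable_injective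
      (f := (subgroupOfEquivOfLe (le_sup_left : K ≤ K ⊔ Subgroup.zpowers g)).toMonoidHom)
      (subgroupOfEquivOfLe _).injective, ?_⟩
    exact Group.isSolvable_of_comm fun a b => (IsCyclic.commGroup).mul_comm a b

end

theorem Subgroup.isCyclic_of_disjoint_of_le_sup_zpowers {G : Type*} [Group G] {K M : Subgroup G}
    {g : G} (hg : g ∈ normalizer (K : Set G)) (hM : M ≤ K ⊔ zpowers g) (h : K ⊓ M = ⊥) :
    IsCyclic ↥M := by
  have hn : (K.subgroupOf (K ⊔ zpowers g)).Normal :=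
    normal_subgroupOf_of_le_normalizer (sup_le le_normalizer (by simpa using hg))
  have hg' : g ∈ K ⊔ zpowers g := mem_sup_right (mem_zpowers g)
  have : IsCyclic (↥(K ⊔ zpowers g) ⧸ K.subgroupOf (K ⊔ zpowers g)) := by
    refine ⟨QuotientGroup.mk ⟨g, hg'⟩, fun q => ?_⟩
    obtain ⟨⟨x, hx⟩, rfl⟩ := QuotientGroup.mk_surjective q
    obtain ⟨k, hk, n, rfl⟩ := (mem_sup_zpowers_iff hg).1 hx
    refine mem_zpowers_iff.2 ⟨n, ?_⟩
    rw [← QuotientGroup.mk_zpow, QuotientGroup.eq, mem_subgroupOf]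
    have := (mem_normalizer_iff.1 (inv_mem (zpow_mem hg n)) k).1 hk
    simpa [mul_assoc] using this
  refine isCyclic_of_injective ((QuotientGroup.mk' (K.subgroupOf (K ⊔ zpowers g))).comp
    (inclusion hM)) ((injective_iff_map_eq_one _).2 fun x hx => ?_)
  have hx : (inclusion hM x) ∈ K.subgroupOf (K ⊔ zpowers g) :=
    (QuotientGroup.eq_one_iff _).1 hx
  have : (x : G) ∈ K ⊓ M := ⟨hx, x.2⟩
  rw [h] at this
  exact Subtype.ext (by simpa using this)

/-- The first term of the series meeting `M` nontrivially meets it in a group that embeds in a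
cyclic factor. This intersection is therefore cyclic, and `A` normalises it. -/
theorem HasCyclicSeries.exists_zpowers {G : Type*} [Group G] {A K : Subgroup G}
    (h : HasCyclicSeries A K) {M : Subgroup G} (hM : A ≤ normalizer (M : Set G))
    (hKM : K ⊓ M ≠ ⊥) :
    ∃ g ∈ K ⊓ M, g ≠ 1 ∧ A ≤ normalizer (Subgroup.zpowers g : Set G) := by
  induction h with
  | bot => exact absurd (bot_inf_eq M) hKM
  | step K g hK hg hn ih =>
    by_cases hb : K ⊓ M = ⊥
    · have hc : IsCyclic ↥((K ⊔ Subgroup.zpowers g) ⊓ M) :=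
        isCyclic_of_disjoint_of_le_sup_zpowers (hK.le_normalizer hg) inf_le_left
          (le_bot_iff.1 (hb ▸ inf_le_inf_left K inf_le_right))
      obtain ⟨t, ht⟩ := isCyclic_iff_exists_zpowers_eq_top.1 hc
      have ht' : Subgroup.zpowers (t : G) = (K ⊔ Subgroup.zpowers g) ⊓ M := by
        have := congrArg (Subgroup.map (Subgroup.subtype _)) ht
        rwa [MonoidHom.map_zpowers, ← MonoidHom.range_eq_map, range_subtype] at this
      refine ⟨t, t.2, fun h1 => hKM ?_, ?_⟩
      · rw [← ht', h1, zpowers_one_eq_bot]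
      · rw [ht']
        exact (le_inf hn hM).trans inf_normalizer_le_normalizer_inf
    · obtain ⟨x, hx, h1, h2⟩ := ih hb
      exact ⟨x, ⟨mem_sup_left hx.1, hx.2⟩, h1, h2⟩

/-! ### Nilpotent groups and Fitting's theorem -/

section Nilpotent

variable {G : Type*} [Group G]

theorem Subgroup.card_quotient_lt [Finite G] {N : Subgroup G} (h : N ≠ ⊥) :
    Nat.card (G ⧸ N) < Nat.card G := by
  rw [← index_eq_card, ← index_bot (G := G)]
  exact index_strictAnti (bot_lt_iff_ne_bot.2 h)

theorem Subgroup.zpowers_normal_of_forall_commute {z : G} (h : ∀ x, x * z = z * x) :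
    (zpowers z).Normal := by
  refine ⟨fun n hn g => ?_⟩
  obtain ⟨k, rfl⟩ := mem_zpowers_iff.1 hn
  have : Commute g (z ^ k) := Commute.zpow_right (h g) k
  rw [this.eq, mul_inv_cancel_right]
  exact hn

/-- In the first upper central term meeting `N`, commutators of elements of `N` fall into the
previous term, which meets `N` trivially. -/
theorem Subgroup.inf_center_ne_bot [Group.IsNilpotent G] {N : Subgroup G} [N.Normal] (h : N ≠ ⊥) :
    N ⊓ center G ≠ ⊥ := by
  classical
  obtain ⟨n, hn⟩ := Group.IsNilpotent.nilpotent G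
  have hex : ∃ n, N ⊓ upperCentralSeries G n ≠ ⊥ := ⟨n, by rwa [hn, inf_top_eq]⟩
  obtain ⟨m, hm⟩ : ∃ m, Nat.find hex = m := ⟨_, rfl⟩
  have h1 := Nat.find_spec hex
  rw [hm] at h1
  cases m with
  | zero => simp at h1
  | succ m =>
    have h2 : N ⊓ upperCentralSeries G m = ⊥ := by
      by_contra hne
      have := Nat.find_min' hex hne
      omega
    obtain ⟨⟨x, hx⟩, hx1⟩ := (Subgroup.ne_bot_iff_exists_ne_one).1 h1
    intro hb
    apply hx1
    have : x ∈ N ⊓ center G := by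
      refine ⟨hx.1, mem_center_iff.2 fun y => ?_⟩
      have : ⁅(x : G), y⁆ ∈ N ⊓ upperCentralSeries G m := by
        refine ⟨?_, mem_upperCentralSeries_succ_iff.1 hx.2 y⟩
        rw [commutatorElement_def, mul_assoc, mul_assoc, ← mul_assoc y]
        exact mul_mem hx.1 (Normal.conj_mem inferInstance _ (inv_mem hx.1) y)
      rw [h2, mem_bot, commutatorElement_eq_one_iff_mul_comm] at this
      exact this.symm
    rw [hb] at this
    exact Subtype.ext (by simpa using this)

theorem Subgroup.map_subtype_center_ne_bot {F : Subgroup G} [Group.IsNilpotent ↥F] (h : F ≠ ⊥) :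
    (center ↥F).map F.subtype ≠ ⊥ := by
  have : Nontrivial ↥F := F.nontrivial_iff_ne_bot.2 h
  rw [Ne, map_eq_bot_iff_of_injective _ F.subtype_injective]
  exact Group.IsNilpotent.center_ne_bot _

theorem Subgroup.mem_map_subtype_center_iff {F : Subgroup G} {z : G} :
    z ∈ (center ↥F).map F.subtype ↔ z ∈ F ∧ ∀ x ∈ F, x * z = z * x := by
  constructor
  · rintro ⟨z, hz, rfl⟩
    exact ⟨z.2, fun x hx => congrArg Subtype.val (mem_center_iff.1 hz ⟨x, hx⟩)⟩
  · rintro ⟨hz, h⟩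
    exact ⟨⟨z, hz⟩, mem_center_iff.2 fun x => Subtype.ext (h x x.2), rfl⟩

theorem Subgroup.forall_commute_of_sup_eq_top {A B : Subgroup G} (h : A ⊔ B = ⊤) {z : G}
    (hA : ∀ a ∈ A, a * z = z * a) (hB : ∀ b ∈ B, b * z = z * b) (x : G) : x * z = z * x := by
  have : A ⊔ B ≤ centralizer {z} :=
    sup_le (fun a ha => mem_centralizer_singleton_iff.2 (hA a ha))
      (fun a ha => mem_centralizer_singleton_iff.2 (hB a ha))
  rw [h] at this
  exact mem_centralizer_singleton_iff.1 (this trivial)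

theorem Subgroup.mul_comm_of_inf_eq_bot {A B : Subgroup G} [A.Normal] [B.Normal] (h : A ⊓ B = ⊥)
    {a b : G} (ha : a ∈ A) (hb : b ∈ B) : a * b = b * a :=
  (commute_of_normal_of_disjoint A B inferInstance inferInstance (disjoint_iff.2 h) a b ha hb).eq

theorem Group.IsNilpotent.of_subgroupOf {F K : Subgroup G} [Group.IsNilpotent ↥F] :
    Group.IsNilpotent ↥(F.subgroupOf K) := by
  let f : ↥(F.subgroupOf K) →* ↥F :=
    { toFun := fun x => ⟨x.1.1, x.2⟩, map_one' := rfl, map_mul' := fun _ _ => rfl }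
  refine Subgroup.isNilpotent_of_ker_le_center f ?_
  have : f.ker = ⊥ := (MonoidHom.ker_eq_bot_iff f).2 fun x y h =>
    Subtype.ext (Subtype.ext (congrArg (fun z : ↥F => (z : G)) h))
  rw [this]
  exact bot_le

theorem Group.IsNilpotent.map_subgroup {Q : Type*} [Group Q] {F : Subgroup G}
    [Group.IsNilpotent ↥F] (f : G →* Q) : Group.IsNilpotent ↥(F.map f) :=
  nilpotent_of_surjective (f.subgroupMap F) (f.subgroupMap_surjective F)

end Nilpotent

universe u

/-- Induction modulo a nontrivial central element. If `H` meets Z(K) trivially, it commutes with it,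
so Z(K) is central in `G`. Otherwise H ∩ Z(K) is normal in `H` and meets Z(H). -/
theorem Group.isNilpotent_of_sup_eq_top {G : Type u} [Group G] [Finite G] (H K : Subgroup G)
    [H.Normal] [K.Normal] [Group.IsNilpotent ↥H] [Group.IsNilpotent ↥K] (h : H ⊔ K = ⊤) :
    Group.IsNilpotent G := by
  suffices ∃ n, Subgroup.upperCentralSeries G n = ⊤ from ⟨this⟩
  induction hn : Nat.card G using Nat.strong_induction_on generalizing G with
  | _ n ih =>
  subst hn
  by_cases hK : K = ⊥
  · rw [hK, sup_bot_eq] at h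
    subst h
    exact (Group.isNilpotent_top.1 inferInstance : Group.IsNilpotent G).nilpotent'
  obtain ⟨z, hz1, hz⟩ : ∃ z : G, z ≠ 1 ∧ ∀ x, x * z = z * x := by
    set M := (center ↥K).map K.subtype with hM
    have hMne : M ≠ ⊥ := map_subtype_center_ne_bot hK
    by_cases hb : H ⊓ M = ⊥
    · obtain ⟨z, hz⟩ := ne_bot_iff_exists_ne_one.1 hMne
      exact ⟨z, fun h1 => hz (Subtype.ext h1), forall_commute_of_sup_eq_top h
        (fun a ha => mul_comm_of_inf_eq_bot hb ha z.2) (mem_map_subtype_center_iff.1 z.2).2⟩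
    · have : M.subgroupOf H ≠ ⊥ := by
        rwa [Ne, subgroupOf_eq_bot, disjoint_iff, inf_comm]
      obtain ⟨z, hz⟩ := ne_bot_iff_exists_ne_one.1 (inf_center_ne_bot this)
      refine ⟨z.1.1, fun h1 => hz (Subtype.ext (Subtype.ext h1)), forall_commute_of_sup_eq_top h
        (fun a ha => ?_) (mem_map_subtype_center_iff.1 z.2.1).2⟩
      exact congrArg Subtype.val (mem_center_iff.1 z.2.2 ⟨a, ha⟩)
  have := zpowers_normal_of_forall_commute hz
  have := Normal.map ‹H.Normal› _ (QuotientGroup.mk'_surjective (zpowers z))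
  have := Normal.map ‹K.Normal› _ (QuotientGroup.mk'_surjective (zpowers z))
  have := Group.IsNilpotent.map_subgroup (F := H) (QuotientGroup.mk' (zpowers z))
  have := Group.IsNilpotent.map_subgroup (F := K) (QuotientGroup.mk' (zpowers z))
  have hN := ih (Nat.card (G ⧸ zpowers z)) (card_quotient_lt (by simpa using hz1))
    (H.map (QuotientGroup.mk' (zpowers z)))
    (K.map (QuotientGroup.mk' (zpowers z)))
    (by rw [← Subgroup.map_sup, h, map_top_of_surjective _ (QuotientGroup.mk'_surjective _)]) rfl
  have : Group.IsNilpotent (G ⧸ zpowers z) := ⟨hN⟩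
  have : Group.IsNilpotent G :=
    Subgroup.isNilpotent_of_ker_le_center (QuotientGroup.mk' (zpowers z)) ?_
  · exact this.nilpotent'
  · rw [QuotientGroup.ker_mk', zpowers_le]
    exact mem_center_iff.2 hz

theorem Subgroup.isNilpotent_sup {G : Type u} [Group G] [Finite G] (H K : Subgroup G)
    [H.Normal] [K.Normal] [Group.IsNilpotent ↥H] [Group.IsNilpotent ↥K] :
    Group.IsNilpotent ↥(H ⊔ K) := by
  have := Group.IsNilpotent.of_subgroupOf (F := H) (K := H ⊔ K)
  have := Group.IsNilpotent.of_subgroupOf (F := K) (K := H ⊔ K)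
  refine Group.isNilpotent_of_sup_eq_top (H.subgroupOf (H ⊔ K)) (K.subgroupOf (H ⊔ K)) ?_
  rw [← subgroupOf_sup le_sup_left le_sup_right, subgroupOf_self]

/-! ### The Fitting subgroup -/

section Fitting

variable {G : Type*} [Group G]

theorem le_fittingSubgroup (N : Subgroup G) [hN : N.Normal] [h : Group.IsNilpotent ↥N] :
    N ≤ fittingSubgroup G :=
  le_sSup ⟨hN, h⟩

theorem fittingSubgroup_normal_and_isNilpotent [Finite G] :
    (fittingSubgroup G).Normal ∧ Group.IsNilpotent ↥(fittingSubgroup G) := by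
  obtain ⟨M, hM⟩ := (Set.toFinite {N : Subgroup G | N.Normal ∧ Group.IsNilpotent ↥N}).exists_maximal
    ⟨⊥, inferInstance, inferInstance⟩
  suffices fittingSubgroup G = M from this ▸ hM.1
  refine le_antisymm (sSup_le fun N hN => ?_) (le_sSup hM.1)
  have := hN.1
  have := hN.2
  have := hM.1.1
  have := hM.1.2
  exact le_sup_left.trans (hM.2 (y := N ⊔ M) ⟨inferInstance, isNilpotent_sup N M⟩ le_sup_right)

instance [Finite G] : (fittingSubgroup G).Normal := fittingSubgroup_normal_and_isNilpotent.1

instance [Finite G] : Group.IsNilpotent ↥(fittingSubgroup G) :=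
  fittingSubgroup_normal_and_isNilpotent.2

end Fitting

/-! ### Supersoluble subnormal times nilpotent normal -/

/-- Induction modulo a normal cyclic subgroup inside Z(F). If `A` meets Z(F) trivially, Z(F) is
central in `G`; otherwise `A` normalises a cyclic subgroup of A ∩ Z(F), and `F` centralises it. -/
theorem IsSupersoluble.of_normal_sup_eq_top {G : Type u} [Group G] [Finite G] (A F : Subgroup G)
    [A.Normal] [F.Normal] [Group.IsNilpotent ↥F] (hA : IsSupersoluble ↥A) (h : A ⊔ F = ⊤) :
    IsSupersoluble G := by
  induction hn : Nat.card G using Nat.strong_induction_on generalizing G with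
  | _ n ih =>
  subst hn
  by_cases hF : F = ⊥
  · rw [hF, sup_bot_eq] at h
    subst h
    exact hA.of_surjective (f := (⊤ : Subgroup G).subtype) fun x => ⟨⟨x, trivial⟩, rfl⟩
  obtain ⟨z, hz1, hz⟩ : ∃ z : G, z ≠ 1 ∧ (zpowers z).Normal := by
    set M := (center ↥F).map F.subtype with hM
    have hMne : M ≠ ⊥ := map_subtype_center_ne_bot hF
    by_cases hb : A ⊓ M = ⊥
    · obtain ⟨z, hz⟩ := ne_bot_iff_exists_ne_one.1 hMne
      exact ⟨z, fun h1 => hz (Subtype.ext h1),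
        zpowers_normal_of_forall_commute (forall_commute_of_sup_eq_top h
          (fun a ha => mul_comm_of_inf_eq_bot hb ha z.2) (mem_map_subtype_center_iff.1 z.2).2)⟩
    · obtain ⟨z, hz, hz1, hzA⟩ := hA.hasCyclicSeries.exists_zpowers (M := M)
        le_normalizer_of_normal hb
      refine ⟨z, hz1, normalizer_eq_top_iff.1 (top_le_iff.1 (h ▸ sup_le hzA fun f hf => ?_))⟩
      have hc : Commute f z := (mem_map_subtype_center_iff.1 hz.2).2 f hf
      have : zpowers f ≤ normalizer (zpowers z : Set G) := by
        refine Subgroup.le_normalizer_iff.2 fun x hx y hy => ?_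
        obtain ⟨i, rfl⟩ := mem_zpowers_iff.1 hx
        obtain ⟨j, rfl⟩ := mem_zpowers_iff.1 hy
        rw [((hc.zpow_left i).zpow_right j).eq, mul_inv_cancel_right]
        exact hy
      exact this (mem_zpowers f)
  refine IsSupersoluble.of_quotient (zpowers z) (HasCyclicSeries.zpowers z) ?_
  have := Normal.map ‹A.Normal› _ (QuotientGroup.mk'_surjective (zpowers z))
  have := Normal.map ‹F.Normal› _ (QuotientGroup.mk'_surjective (zpowers z))
  have := Group.IsNilpotent.map_subgroup (F := F) (QuotientGroup.mk' (zpowers z))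
  exact ih (Nat.card (G ⧸ zpowers z)) (card_quotient_lt (by simpa using hz1))
    (A.map (QuotientGroup.mk' (zpowers z))) (F.map (QuotientGroup.mk' (zpowers z)))
    (hA.map _)
    (by rw [← Subgroup.map_sup, h, map_top_of_surjective _ (QuotientGroup.mk'_surjective _)]) rfl

theorem IsSupersoluble.of_isSubnormal_sup_eq_top {G : Type u} [Group G] [Finite G]
    {A F : Subgroup G} [F.Normal] [Group.IsNilpotent ↥F] (hs : A.IsSubnormal)
    (hA : IsSupersoluble ↥A) (h : A ⊔ F = ⊤) : IsSupersoluble G := by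
  induction hs with
  | top => exact hA.of_surjective (f := (⊤ : Subgroup G).subtype) fun x => ⟨⟨x, trivial⟩, rfl⟩
  | step H K hle _ hN ih =>
    have := Group.IsNilpotent.of_subgroupOf (F := F) (K := K)
    refine ih (IsSupersoluble.of_normal_sup_eq_top (H.subgroupOf K) (F.subgroupOf K) ?_ ?_)
      (top_le_iff.1 (h ▸ sup_le_sup_right hle F))
    · exact hA.of_surjective (f := (subgroupOfEquivOfLe hle).symm.toMonoidHom)
        (subgroupOfEquivOfLe hle).symm.surjective
    -- Dedekind's law: `H ≤ K` and HF = G give K = H(F ∩ K).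
    · refine top_le_iff.1 fun x _ => ?_
      have hx : (x : G) ∈ H ⊔ F := h ▸ trivial
      obtain ⟨a, ha, f, hf, hx⟩ := mem_sup_of_normal_right.1 hx
      have hfK : f ∈ K := by
        rw [eq_inv_mul_of_mul_eq hx]
        exact mul_mem (inv_mem (hle ha)) x.2
      have : x = ⟨a, hle ha⟩ * ⟨f, hfK⟩ := Subtype.ext hx.symm
      rw [this]
      exact mul_mem_sup ha hf

theorem IsSupersoluble.sup_of_isRelSubnormal {G : Type u} [Group G] [Finite G] {A F : Subgroup G}
    [F.Normal] [Group.IsNilpotent ↥F] (hA : IsSupersoluble ↥A) (hs : F.IsRelSubnormal A) :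
    IsSupersoluble ↥(A ⊔ F) := by
  have := Group.IsNilpotent.of_subgroupOf (F := F) (K := A ⊔ F)
  refine IsSupersoluble.of_isSubnormal_sup_eq_top (F := F.subgroupOf (A ⊔ F)) hs ?_ ?_
  · exact hA.of_surjective
      (f := (subgroupOfEquivOfLe (le_sup_left : A ≤ A ⊔ F)).symm.toMonoidHom)
      (subgroupOfEquivOfLe _).symm.surjective
  · rw [← subgroupOf_sup le_sup_left le_sup_right, subgroupOf_self]

/-! ### Subgroups of coprime index, and solubility -/

section Coprime

variable {G : Type*} [Group G] {A B C : Subgroup G}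

/-- By coprimality |G : B| divides |A : A ∩ B|, so the `A`-orbit of the trivial coset fills G/B. -/
theorem Subgroup.exists_mul_eq_of_coprime_index [Finite G] (h : Nat.Coprime A.index B.index) (g : G) :
    ∃ a ∈ A, ∃ b ∈ B, a * b = g := by
  have hdvd : B.index ∣ B.relIndex A := by
    refine Nat.Coprime.dvd_of_dvd_mul_right h.symm ?_
    rw [← inf_relIndex_right, relIndex_mul_index inf_le_right]
    exact index_dvd_of_le inf_le_left
  have hstab : MulAction.stabilizer ↥A ((1 : G) : G ⧸ B) = B.subgroupOf A := by
    ext a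
    rw [MulAction.mem_stabilizer_iff, mem_subgroupOf]
    change ((((a : G) * 1 : G) : G ⧸ B) = _) ↔ _
    rw [mul_one, eq_comm, QuotientGroup.eq]
    simp
  have hcard : (MulAction.orbit ↥A ((1 : G) : G ⧸ B)).ncard = B.relIndex A := by
    rw [← MulAction.index_stabilizer, hstab]
    rfl
  have huniv : MulAction.orbit ↥A ((1 : G) : G ⧸ B) = Set.univ := by
    refine Set.eq_of_subset_of_ncard_le (Set.subset_univ _) ?_
    rw [hcard, Set.ncard_univ, ← index_eq_card]
    refine Nat.le_of_dvd (Nat.pos_of_ne_zero fun h0 => ?_) hdvd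
    exact index_ne_zero_of_finite (H := B) (index_eq_zero_of_relIndex_eq_zero h0)
  obtain ⟨a, ha⟩ : (g : G ⧸ B) ∈ MulAction.orbit ↥A ((1 : G) : G ⧸ B) := huniv ▸ Set.mem_univ _
  have ha : (((a : G) * 1 : G) : G ⧸ B) = g := ha
  rw [mul_one, QuotientGroup.eq] at ha
  exact ⟨a, a.2, _, ha, by group⟩

theorem Subgroup.sup_eq_top_of_coprime_index [Finite G] (h : Nat.Coprime A.index B.index) :
    A ⊔ B = ⊤ := by
  refine top_le_iff.1 fun g _ => ?_
  obtain ⟨a, ha, b, hb, rfl⟩ := exists_mul_eq_of_coprime_index h g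
  exact mul_mem_sup ha hb

theorem Nat.Prime.not_dvd_index_pair {q : ℕ} (hq : q.Prime) (hAB : Nat.Coprime A.index B.index)
    (hBC : Nat.Coprime B.index C.index) (hAC : Nat.Coprime A.index C.index) :
    (¬ q ∣ A.index ∧ ¬ q ∣ B.index) ∨ (¬ q ∣ B.index ∧ ¬ q ∣ C.index) ∨
      (¬ q ∣ A.index ∧ ¬ q ∣ C.index) := by
  have h1 := fun h h' => Nat.not_coprime_of_dvd_of_dvd hq.one_lt h h' hAB
  have h2 := fun h h' => Nat.not_coprime_of_dvd_of_dvd hq.one_lt h h' hBC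
  have h3 := fun h h' => Nat.not_coprime_of_dvd_of_dvd hq.one_lt h h' hAC
  tauto

theorem Subgroup.coprime_index_map {Q : Type*} [Group Q] {f : G →* Q}
    (hf : Function.Surjective f) (h : Nat.Coprime A.index B.index) :
    Nat.Coprime (A.map f).index (B.map f).index :=
  Nat.Coprime.of_dvd (index_map_dvd A hf) (index_map_dvd B hf) h

/-- The p-group `N` fixes a coset of `B`, so some conjugate of `N` lies in `B`. Since G = BA and `A`
normalises `N`, all conjugates of `N` are conjugates under `B`, so all lie in `B`. -/
theorem IsPGroup.le_normalCore_of_coprime_index [Finite G] {p : ℕ} [Fact p.Prime] {N : Subgroup G}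
    (hN : IsPGroup p ↥N) (hA : A ≤ normalizer (N : Set G)) (hp : ¬ p ∣ B.index)
    (h : Nat.Coprime A.index B.index) : N ≤ B.normalCore := by
  obtain ⟨q, hq⟩ := hN.nonempty_fixed_point_of_prime_not_dvd_card (G ⧸ B)
    (by rwa [← index_eq_card])
  obtain ⟨g, rfl⟩ := QuotientGroup.mk_surjective q
  have key : ∀ a ∈ A, ∀ b ∈ B, ∀ n, b * a * n * (b * a)⁻¹ ∈ B ↔ a * n * a⁻¹ ∈ B := by
    intro a _ b hb n
    have : b * a * n * (b * a)⁻¹ = b * (a * n * a⁻¹) * b⁻¹ := by group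
    rw [this]
    exact ((mem_normalizer_iff.1 (le_normalizer hb)) _).symm
  have hfix : ∀ n ∈ N, g⁻¹ * n * g⁻¹⁻¹ ∈ B := by
    intro n hn
    have : (((n : G) * g : G) : G ⧸ B) = g := hq ⟨n, hn⟩
    rw [eq_comm, QuotientGroup.eq] at this
    simpa [mul_assoc] using this
  have hle : N ≤ B := by
    intro n hn
    obtain ⟨b, hb, a, ha, hg⟩ := exists_mul_eq_of_coprime_index h.symm g⁻¹
    have hn' : a⁻¹ * n * a ∈ N := (mem_normalizer_iff''.1 (hA ha) n).1 hn
    have := hfix _ hn'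
    rw [← hg, key a ha b hb] at this
    simpa [mul_assoc] using this
  intro n hn g
  obtain ⟨b, hb, a, ha, rfl⟩ := exists_mul_eq_of_coprime_index h.symm g
  exact (key a ha b hb n).2 (hle ((mem_normalizer_iff.1 (hA ha) n).1 hn))

theorem IsSupersoluble.exists_prime_zpowers [Finite G] (hA : IsSupersoluble ↥A) {M : Subgroup G}
    (hM : A ≤ normalizer (M : Set G)) (h : A ⊓ M ≠ ⊥) :
    ∃ g ∈ A ⊓ M, (orderOf g).Prime ∧ A ≤ normalizer (zpowers g : Set G) := by
  obtain ⟨g, hg, hg1, hgA⟩ := hA.hasCyclicSeries.exists_zpowers hM h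
  have hp : (orderOf g).minFac.Prime := Nat.minFac_prime (by rwa [Ne, orderOf_eq_one_iff])
  have ho : 0 < orderOf g := orderOf_pos g
  -- Subgroups of a cyclic group are characteristic, so `A` also normalises the one of prime order.
  refine ⟨g ^ (orderOf g / (orderOf g).minFac), pow_mem hg _, ?_, ?_⟩
  · rwa [orderOf_pow_orderOf_div ho.ne' (Nat.minFac_dvd _)]
  · refine Subgroup.le_normalizer_iff.2 fun a ha x hx => ?_
    obtain ⟨j, rfl⟩ := mem_zpowers_iff.1 hx
    obtain ⟨i, hi⟩ := mem_zpowers_iff.1 ((mem_normalizer_iff.1 (hgA ha) g).1 (mem_zpowers g))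
    refine mem_zpowers_iff.2 ⟨i * j, ?_⟩
    rw [← conj_zpow, ← conj_pow, ← hi, zpow_mul, ← zpow_natCast, ← zpow_natCast, ← zpow_mul g,
      mul_comm _ i, zpow_mul]

end Coprime

/-- `A` normalises a subgroup of prime order p, and p cannot divide both |G : B| and |G : C|. So `B`
or `C` has a nontrivial core, which is soluble, and induction handles the quotient. -/
theorem Group.isSolvable_of_coprime_index {G : Type u} [Group G] [Finite G] {A B C : Subgroup G}
    (hA : IsSupersoluble ↥A) (hB : IsSupersoluble ↥B) (hC : IsSupersoluble ↥C)
    (hAB : Nat.Coprime A.index B.index) (hBC : Nat.Coprime B.index C.index)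
    (hAC : Nat.Coprime A.index C.index) : Group.IsSolvable G := by
  induction hn : Nat.card G using Nat.strong_induction_on generalizing G with
  | _ n ih =>
  subst hn
  have quot : ∀ D : Subgroup G, IsSupersoluble ↥D → D.normalCore ≠ ⊥ → Group.IsSolvable G := by
    intro D hD hne
    have hf := QuotientGroup.mk'_surjective D.normalCore
    rw [Group.isSolvable_iff_subgroup_quotient D.normalCore]
    have := hD.isSolvable
    exact ⟨Group.isSolvable_of_isSolvable_injective (inclusion_injective D.normalCore_le),
      ih _ (card_quotient_lt hne) (hA.map _) (hB.map _) (hC.map _) (coprime_index_map hf hAB)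
        (coprime_index_map hf hBC) (coprime_index_map hf hAC) rfl⟩
  by_cases hbot : A = ⊥
  · have hB1 : B = ⊤ := by
      rw [← index_eq_one]
      refine Nat.Coprime.eq_one_of_dvd hAB.symm ?_
      rw [hbot, index_bot]
      exact B.index_dvd_card
    subst hB1
    have := hB.isSolvable
    exact Group.isSolvable_of_surjective (G := (⊤ : Subgroup G)) (f := (⊤ : Subgroup G).subtype)
      (fun x => ⟨⟨x, trivial⟩, rfl⟩)
  obtain ⟨g, -, hp, hgA⟩ := hA.exists_prime_zpowers (M := ⊤) le_normalizer_of_normal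
    (by rwa [inf_top_eq])
  have := Fact.mk hp
  have hP : IsPGroup (orderOf g) ↥(zpowers g) := by
    refine IsPGroup.of_card (n := 1) ?_
    rw [Nat.card_zpowers, pow_one]
  have hne : ∀ D : Subgroup G, zpowers g ≤ D.normalCore → D.normalCore ≠ ⊥ := by
    intro D hD h
    rw [h, le_bot_iff, zpowers_eq_bot] at hD
    rw [hD, orderOf_one] at hp
    exact Nat.not_prime_one hp
  by_cases hB' : orderOf g ∣ B.index
  · have hC' : ¬ orderOf g ∣ C.index := fun h =>
      Nat.not_coprime_of_dvd_of_dvd hp.one_lt hB' h hBC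
    exact quot C hC (hne C (hP.le_normalCore_of_coprime_index hgA hC' hAC))
  · exact quot B hB (hne B (hP.le_normalCore_of_coprime_index hgA hB' hAB))

/-! ### Normal Sylow subgroups and a commutativity criterion -/

section Sylow

variable {G : Type*} [Group G] [Finite G]

theorem Sylow.exists_le_of_isPGroup_commutator {p : ℕ} [Fact p.Prime] {A : Subgroup G}
    (hA : IsPGroup p ↥⁅A, A⁆) (hp : ¬ p ∣ A.index) :
    ∃ P : Sylow p G, (P : Subgroup G) ≤ A ∧ A ≤ normalizer ((P : Subgroup G) : Set G) := by
  obtain ⟨S⟩ : Nonempty (Sylow p ↥A) := inferInstance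
  have hc : IsPGroup p ↥(commutator ↥A) := by
    rw [← map_subtype_commutator] at hA
    exact hA.of_equiv (equivMapOfInjective _ _ A.subtype_injective).symm
  -- A normal p-subgroup lies in every Sylow p-subgroup, so `S` contains A'.
  have hS : (S : Subgroup ↥A).Normal := Normal.of_commutator_le _ (hc.le_sylow_of_normal S)
  have hind : ¬ p ∣ ((S : Subgroup ↥A).map A.subtype).index := by
    rw [index_map_subtype, (Fact.out : p.Prime).dvd_mul]
    exact not_or_intro S.not_dvd_index hp
  refine ⟨(S.isPGroup'.map A.subtype).toSylow hind, map_subtype_le _, ?_⟩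
  refine le_trans ?_ (le_normalizer_map A.subtype)
  rw [normalizer_eq_top, ← MonoidHom.range_eq_map, range_subtype]

theorem Sylow.exists_normal_of_coprime_index {p : ℕ} [Fact p.Prime] {A B : Subgroup G}
    (hA : IsPGroup p ↥⁅A, A⁆) (hB : IsPGroup p ↥⁅B, B⁆) (hpA : ¬ p ∣ A.index)
    (hpB : ¬ p ∣ B.index) (h : Nat.Coprime A.index B.index) :
    ∃ P : Sylow p G, (P : Subgroup G).Normal ∧ (P : Subgroup G) ≤ A ∧ (P : Subgroup G) ≤ B := by
  obtain ⟨P, hPA, hAP⟩ := exists_le_of_isPGroup_commutator hA hpA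
  obtain ⟨R, hRB, hBR⟩ := exists_le_of_isPGroup_commutator hB hpB
  obtain ⟨g, rfl⟩ := MulAction.exists_smul_eq G P R
  obtain ⟨b, hb, a, ha, rfl⟩ := exists_mul_eq_of_coprime_index h.symm g
  -- The conjugating element is `b * a`; `a` fixes `P` and `b` fixes the other Sylow subgroup, so
  -- the two coincide.
  have h1 : a • P = P := Sylow.smul_eq_iff_mem_normalizer.2 (hAP ha)
  rw [mul_smul, h1] at hRB hBR
  have h2 : b⁻¹ • b • P = b • P := Sylow.smul_eq_iff_mem_normalizer.2 (hBR (inv_mem hb))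
  rw [inv_smul_smul] at h2
  rw [← h2] at hRB hBR
  exact ⟨P, normalizer_eq_top_iff.1
    (top_le_iff.1 (sup_eq_top_of_coprime_index h ▸ sup_le hAP hBR)), hPA, hRB⟩

/-- Two of the indices are prime to p, giving a normal Sylow p-subgroup, trivial by `hO`. So `A`,
`B`, `C` are abelian. For each prime q, two of them contain a common Sylow q-subgroup and generate
`G`, so that subgroup is central. -/
theorem mul_comm_of_isPGroup_commutator_of_coprime_index {p : ℕ} [Fact p.Prime]
    {A B C : Subgroup G} (hO : ∀ P : Subgroup G, P.Normal → IsPGroup p ↥P → P = ⊥)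
    (hA : IsPGroup p ↥⁅A, A⁆) (hB : IsPGroup p ↥⁅B, B⁆) (hC : IsPGroup p ↥⁅C, C⁆)
    (hAB : Nat.Coprime A.index B.index) (hBC : Nat.Coprime B.index C.index)
    (hAC : Nat.Coprime A.index C.index) (x y : G) : x * y = y * x := by
  obtain ⟨P, hP⟩ : ∃ P : Sylow p G, (P : Subgroup G).Normal := by
    rcases (Fact.out : p.Prime).not_dvd_index_pair hAB hBC hAC with h | h | h
    · exact (Sylow.exists_normal_of_coprime_index hA hB h.1 h.2 hAB).imp fun _ h => h.1
    · exact (Sylow.exists_normal_of_coprime_index hB hC h.1 h.2 hBC).imp fun _ h => h.1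
    · exact (Sylow.exists_normal_of_coprime_index hA hC h.1 h.2 hAC).imp fun _ h => h.1
  have hbot : ∀ D : Subgroup G, IsPGroup p ↥D → D = ⊥ := fun D hD => by
    have h0 := hO P hP P.isPGroup'
    rw [P.is_maximal' hD (by rw [h0]; exact bot_le), ← h0]
  have habel : ∀ D : Subgroup G, ⁅D, D⁆ = ⊥ → ∀ q : ℕ, IsPGroup q ↥⁅D, D⁆ := fun D hD q => by
    rw [hD]
    exact IsPGroup.of_bot
  have hA := hbot _ hA
  have hB := hbot _ hB
  have hC := hbot _ hC
  have pair : ∀ D E : Subgroup G, ⁅D, D⁆ = ⊥ → ⁅E, E⁆ = ⊥ → Nat.Coprime D.index E.index →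
      ∀ q : ℕ, q.Prime → ¬ q ∣ D.index → ¬ q ∣ E.index → ¬ q ∣ (center G).index := by
    intro D E hD hE hDE q hq hqD hqE
    have := Fact.mk hq
    obtain ⟨R, -, hRD, hRE⟩ := Sylow.exists_normal_of_coprime_index (habel D hD q)
      (habel E hE q) hqD hqE hDE
    rw [commutator_eq_bot_iff_le_centralizer] at hD hE
    refine fun hdvd => R.not_dvd_index (hdvd.trans (index_dvd_of_le fun r hr => ?_))
    exact mem_center_iff.2 (forall_commute_of_sup_eq_top (sup_eq_top_of_coprime_index hDE)
      (fun a ha => (mem_centralizer_iff.1 (hD ha) r (hRD hr)).symm)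
      (fun a ha => (mem_centralizer_iff.1 (hE ha) r (hRE hr)).symm))
  have hcen : (center G).index = 1 := by
    refine Nat.eq_one_iff_not_exists_prime_dvd.2 fun q hq => ?_
    rcases hq.not_dvd_index_pair hAB hBC hAC with h | h | h
    · exact pair A B hA hB hAB q hq h.1 h.2
    · exact pair B C hB hC hBC q hq h.1 h.2
    · exact pair A C hA hC hAC q hq h.1 h.2
  have hy : y ∈ center G := (index_eq_one.1 hcen) ▸ trivial
  exact mem_center_iff.1 hy x

end Sylow

/-! ### Action of the derived subgroup on a cyclic series -/

section

variable {G : Type*} [Group G]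

/-- Conjugations act on a normal cyclic subgroup as power maps, and these commute. -/
theorem Subgroup.commute_of_mem_commutator_of_normal_zpowers {q : G} [(zpowers q).Normal] {y : G}
    (hy : y ∈ _root_.commutator G) : Commute y q := by
  suffices _root_.commutator G ≤ centralizer {q} from mem_centralizer_singleton_iff.1 (this hy)
  have hconj : ∀ g : G, ∃ i : ℤ, q ^ i = g * q * g⁻¹ := fun g =>
    mem_zpowers_iff.1 (Normal.conj_mem inferInstance q (mem_zpowers q) g)
  rw [_root_.commutator_def, commutator_le]
  intro a _ b _
  obtain ⟨i, hi⟩ := hconj a⁻¹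
  obtain ⟨j, hj⟩ := hconj b⁻¹
  have h : a⁻¹ * b⁻¹ * q * (a⁻¹ * b⁻¹)⁻¹ = b⁻¹ * a⁻¹ * q * (b⁻¹ * a⁻¹)⁻¹ := by
    calc a⁻¹ * b⁻¹ * q * (a⁻¹ * b⁻¹)⁻¹ = a⁻¹ * (b⁻¹ * q * b⁻¹⁻¹) * a⁻¹⁻¹ := by group
      _ = b⁻¹ * (a⁻¹ * q * a⁻¹⁻¹) * b⁻¹⁻¹ := by
        rw [← hi, ← hj, ← conj_zpow, ← conj_zpow, ← hi, ← hj, ← zpow_mul, ← zpow_mul, mul_comm]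
      _ = b⁻¹ * a⁻¹ * q * (b⁻¹ * a⁻¹)⁻¹ := by group
  rw [mem_centralizer_singleton_iff, commutatorElement_def]
  calc a * b * a⁻¹ * b⁻¹ * q
      = a * b * (a⁻¹ * b⁻¹ * q * (a⁻¹ * b⁻¹)⁻¹) * a⁻¹ * b⁻¹ := by group
    _ = q * (a * b * a⁻¹ * b⁻¹) := by rw [h]; group

theorem Subgroup.commutatorElement_mem_of_mem_commutator {K : Subgroup G} [K.Normal] {g y m : G}
    [(K ⊔ zpowers g).Normal] (hy : y ∈ _root_.commutator G) (hm : m ∈ K ⊔ zpowers g) :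
    ⁅y, m⁆ ∈ K := by
  set f := QuotientGroup.mk' K with hf
  have hz : (K ⊔ zpowers g).map f = zpowers (f g) := by
    rw [Subgroup.map_sup, MonoidHom.map_zpowers, QuotientGroup.map_mk'_self, bot_sup_eq]
  have hn : (zpowers (f g)).Normal :=
    hz ▸ Normal.map inferInstance f (QuotientGroup.mk'_surjective K)
  have hfy : f y ∈ _root_.commutator (G ⧸ K) := by
    have := mem_map_of_mem f hy
    rw [map_commutator_eq] at this
    exact commutator_mono le_top le_top this
  have hfm : f m ∈ zpowers (f g) := hz ▸ mem_map_of_mem f hm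
  obtain ⟨i, hi⟩ := mem_zpowers_iff.1 hfm
  have : Commute (f y) (f m) := hi ▸ (commute_of_mem_commutator_of_normal_zpowers hfy).zpow_right i
  rw [← QuotientGroup.ker_mk' K, MonoidHom.mem_ker, map_commutatorElement]
  exact this.commutator_eq

theorem HasCyclicSeries.exists_pow_commute {p : ℕ} {N K : Subgroup G} [N.Normal]
    (hp : ∀ x ∈ N, x ^ p = 1) (h : HasCyclicSeries ⊤ K) {x : G} (hx : x ∈ _root_.commutator G) :
    ∃ k : ℕ, ∀ m ∈ K ⊓ N, Commute (x ^ p ^ k) m := by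
  induction h with
  | bot =>
    refine ⟨0, fun m hm => ?_⟩
    rw [bot_inf_eq, mem_bot] at hm
    exact hm ▸ Commute.one_right _
  | step K g hK _ hn ih =>
    obtain ⟨k, hk⟩ := ih
    have := hK.normal
    have hKg : (K ⊔ Subgroup.zpowers g).Normal := normalizer_eq_top_iff.1 (top_le_iff.1 hn)
    refine ⟨k + 1, fun m hm => ?_⟩
    rw [pow_succ, pow_mul]
    set y := x ^ p ^ k with hy
    have hyc : y ∈ _root_.commutator G := pow_mem hx _
    have ht : ⁅y, m⁆ ∈ K ⊓ N := by
      refine ⟨commutatorElement_mem_of_mem_commutator hyc hm.1, ?_⟩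
      exact mul_mem (Normal.conj_mem inferInstance m hm.2 y) (N.inv_mem hm.2)
    have hc : Commute y ⁅y, m⁆ := hk _ ht
    have key : ∀ j : ℕ, y ^ j * m = ⁅y, m⁆ ^ j * m * y ^ j := by
      intro j
      induction j with
      | zero => simp
      -- With t = ⁅y, m⁆ commuting with y, each y passing m costs one t. At j = p the factor t ^ p
      -- vanishes.
      | succ j ihj =>
        have h1 : y * m = ⁅y, m⁆ * m * y := by rw [commutatorElement_def]; group
        calc y ^ (j + 1) * m = y * (y ^ j * m) := by rw [pow_succ', mul_assoc]
          _ = y * ⁅y, m⁆ ^ j * (m * y ^ j) := by rw [ihj]; group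
          _ = ⁅y, m⁆ ^ j * (y * m) * y ^ j := by rw [(hc.pow_right j).eq]; group
          _ = ⁅y, m⁆ ^ (j + 1) * m * y ^ (j + 1) := by
            rw [h1, pow_succ, pow_succ']; simp only [mul_assoc]
    have := key p
    rw [hp _ ht.2, one_mul] at this
    exact this

theorem IsSupersoluble.exists_pow_commute {p : ℕ} {A N : Subgroup G} [N.Normal]
    (hA : IsSupersoluble ↥A) (hNA : N ≤ A) (hp : ∀ x ∈ N, x ^ p = 1) {x : G} (hx : x ∈ ⁅A, A⁆) :
    ∃ k : ℕ, ∀ m ∈ N, Commute (x ^ p ^ k) m := by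
  rw [← map_subtype_commutator] at hx
  obtain ⟨x, hx, rfl⟩ := hx
  obtain ⟨k, hk⟩ := (isSupersoluble_iff.1 hA).exists_pow_commute (p := p) (N := N.subgroupOf A)
    (fun y hy => Subtype.ext (hp y hy)) hx
  refine ⟨k, fun m hm => ?_⟩
  exact congrArg Subtype.val (hk ⟨m, hNA hm⟩ ⟨trivial, hm⟩).eq

end

/-! ### Minimal normal subgroups -/

section Minimal

variable {G : Type*} [Group G] {N : Subgroup G} [N.Normal]

theorem Subgroup.mul_comm_of_minimal_normal [Group.IsNilpotent ↥N] (hne : N ≠ ⊥)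
    (hmin : ∀ M : Subgroup G, M.Normal → M ≤ N → M ≠ ⊥ → M = N) {x y : G} (hx : x ∈ N)
    (hy : y ∈ N) : x * y = y * x := by
  have h := hmin ((center ↥N).map N.subtype) inferInstance (map_subtype_le _)
    (map_subtype_center_ne_bot hne)
  rw [← h] at hy
  exact (mem_map_subtype_center_iff.1 hy).2 x hx

theorem Subgroup.exists_prime_pow_eq_one_of_minimal_normal [Finite G] [Group.IsNilpotent ↥N]
    (hne : N ≠ ⊥) (hmin : ∀ M : Subgroup G, M.Normal → M ≤ N → M ≠ ⊥ → M = N) :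
    ∃ p : ℕ, p.Prime ∧ p ∣ Nat.card ↥N ∧ ∀ x ∈ N, x ^ p = 1 := by
  have hcomm : ∀ x ∈ N, ∀ y ∈ N, Commute x y := fun x hx y hy =>
    mul_comm_of_minimal_normal hne hmin hx hy
  obtain ⟨p, hp, hdvd⟩ := Nat.exists_prime_and_dvd (n := Nat.card ↥N)
    (by rwa [Ne, Subgroup.card_eq_one])
  have := Fact.mk hp
  let M : Subgroup G :=
    { carrier := {x | x ∈ N ∧ x ^ p = 1}
      one_mem' := ⟨one_mem _, one_pow _⟩
      mul_mem' := fun {x y} hx hy => ⟨mul_mem hx.1 hy.1, by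
        rw [(hcomm x hx.1 y hy.1).mul_pow, hx.2, hy.2, one_mul]⟩
      inv_mem' := fun {x} hx => ⟨inv_mem hx.1, by rw [inv_pow, hx.2, inv_one]⟩ }
  have hM : M.Normal := ⟨fun x hx g => ⟨Normal.conj_mem inferInstance x hx.1 g, by
    rw [conj_pow, hx.2, mul_one, mul_inv_cancel]⟩⟩
  obtain ⟨x, hx⟩ := exists_prime_orderOf_dvd_card' (G := ↥N) p hdvd
  refine ⟨p, hp, hdvd, fun y hy => ?_⟩
  rw [← hmin M hM (fun x hx => hx.1) ?_] at hy
  · exact hy.2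
  · intro hb
    have hxM : (x : G) ∈ M := ⟨x.2, by
      rw [← hx]; exact congrArg Subtype.val (pow_orderOf_eq_one x)⟩
    rw [hb, mem_bot] at hxM
    have : x = 1 := Subtype.ext hxM
    rw [this, orderOf_one] at hx
    exact hp.one_lt.ne hx

/-- This yields O_p(G/C_G(N)) = 1. `M` acts on `N` as a p-group, so it has a nontrivial fixed point;
the fixed points form a normal subgroup of `G`, hence all of `N`. -/
theorem Subgroup.le_centralizer_of_minimal_normal [Finite G] {p : ℕ} [Fact p.Prime]
    (hdvd : p ∣ Nat.card ↥N) (hmin : ∀ M : Subgroup G, M.Normal → M ≤ N → M ≠ ⊥ → M = N)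
    {M : Subgroup G} [M.Normal]
    (hM : ∀ x ∈ M, ∃ k : ℕ, x ^ p ^ k ∈ centralizer (N : Set G)) :
    M ≤ centralizer (N : Set G) := by
  set φ : G →* MulAut ↥N := MulAut.conjNormal with hφ
  have hW : IsPGroup p ↥(M.map φ) := by
    rw [isPGroup_iff_pow_pow_eq_one]
    rintro ⟨_, x, hx, rfl⟩
    obtain ⟨k, hk⟩ := hM x hx
    refine ⟨k, Subtype.ext ?_⟩
    change φ x ^ p ^ k = 1
    rw [← map_pow]
    ext n
    rw [hφ, MulAut.conjNormal_apply, MulAut.one_apply, ← mem_centralizer_iff.1 hk n n.2,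
      mul_inv_cancel_right]
  obtain ⟨n, hn, hn1⟩ := hW.exists_fixed_point_of_prime_dvd_card_of_fixed_point ↥N hdvd
    (a := 1) (fun w => map_one (w : MulAut ↥N))
  have hfix : ∀ x ∈ M, x * n = n * x := by
    intro x hx
    have h1 : φ x n = n := hn ⟨φ x, x, hx, rfl⟩
    have h2 : x * n * x⁻¹ = n := congrArg Subtype.val h1
    exact mul_inv_eq_iff_eq_mul.1 h2
  have hNM : N ⊓ centralizer (M : Set G) = N := by
    refine hmin _ inferInstance inf_le_left fun hb => hn1 ?_
    have : (n : G) ∈ N ⊓ centralizer (M : Set G) := ⟨n.2, mem_centralizer_iff.2 hfix⟩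
    rw [hb, mem_bot] at this
    exact Subtype.ext this.symm
  rw [le_centralizer_iff]
  exact inf_eq_left.1 hNM

theorem Subgroup.commutator_le_centralizer_of_minimal_normal [Finite G] {A B C : Subgroup G}
    {p : ℕ} [Fact p.Prime] (hdvd : p ∣ Nat.card ↥N) (hp : ∀ x ∈ N, x ^ p = 1)
    (hmin : ∀ M : Subgroup G, M.Normal → M ≤ N → M ≠ ⊥ → M = N)
    (hA : IsSupersoluble ↥A) (hB : IsSupersoluble ↥B) (hC : IsSupersoluble ↥C)
    (hNA : N ≤ A) (hNB : N ≤ B) (hNC : N ≤ C)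
    (hAB : Nat.Coprime A.index B.index) (hBC : Nat.Coprime B.index C.index)
    (hAC : Nat.Coprime A.index C.index) (x y : G) : ⁅x, y⁆ ∈ centralizer (N : Set G) := by
  set f := QuotientGroup.mk' (centralizer (N : Set G)) with hf
  have hsurj : Function.Surjective f := QuotientGroup.mk'_surjective _
  have hker : f.ker = centralizer (N : Set G) := QuotientGroup.ker_mk' _
  have hcomm : ∀ D : Subgroup G, IsSupersoluble ↥D → N ≤ D →
      IsPGroup p ↥⁅D.map f, D.map f⁆ := by
    intro D hD hND
    rw [← map_commutator, isPGroup_iff_pow_pow_eq_one]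
    rintro ⟨_, x, hx, rfl⟩
    obtain ⟨k, hk⟩ := hD.exists_pow_commute hND hp hx
    refine ⟨k, Subtype.ext ?_⟩
    change f x ^ p ^ k = 1
    rw [← map_pow, ← MonoidHom.mem_ker, hker]
    exact mem_centralizer_iff.2 fun n hn => (hk n hn).eq.symm
  have hO : ∀ P : Subgroup (G ⧸ centralizer (N : Set G)), P.Normal → IsPGroup p ↥P → P = ⊥ := by
    intro P hP hPp
    have h1 : P.comap f ≤ f.ker := by
      rw [hker]
      refine le_centralizer_of_minimal_normal hdvd hmin (M := P.comap f) fun x hx => ?_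
      obtain ⟨k, hk⟩ := isPGroup_iff_pow_pow_eq_one.1 hPp ⟨f x, hx⟩
      refine ⟨k, ?_⟩
      rw [← hker, MonoidHom.mem_ker, map_pow]
      exact congrArg Subtype.val hk
    rw [← map_comap_eq_self_of_surjective hsurj P, Subgroup.map_eq_bot_iff]
    exact h1
  have := mul_comm_of_isPGroup_commutator_of_coprime_index hO (hcomm A hA hNA) (hcomm B hB hNB)
    (hcomm C hC hNC) (coprime_index_map hsurj hAB) (coprime_index_map hsurj hBC)
    (coprime_index_map hsurj hAC) (f x) (f y)
  rw [← hker, MonoidHom.mem_ker, map_commutatorElement, commutatorElement_eq_one_iff_mul_comm, this]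

theorem Subgroup.mem_normalizer_zpowers_of_minimal_normal [Finite G] {A : Subgroup G}
    (hcomm : ∀ x ∈ N, ∀ y ∈ N, x * y = y * x) (hne : N ≠ ⊥)
    (hmin : ∀ M : Subgroup G, M.Normal → M ≤ N → M ≠ ⊥ → M = N)
    (hA : IsSupersoluble ↥A) (hNA : N ≤ A)
    (hcen : ∀ x y : G, ⁅x, y⁆ ∈ centralizer (N : Set G)) {m : G} (hm : m ∈ N) :
    A ≤ normalizer (zpowers m : Set G) := by
  obtain ⟨n, hn, hn1, hAn⟩ := hA.hasCyclicSeries.exists_zpowers (M := N) le_normalizer_of_normal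
    (by rwa [inf_eq_right.2 hNA])
  refine Subgroup.le_normalizer_iff.2 fun a ha x hx => ?_
  obtain ⟨i, hi⟩ := mem_zpowers_iff.1 ((mem_normalizer_iff.1 (hAn ha) n).1 (mem_zpowers n))
  -- `E` is where `a` acts as the `i`-th power. It is normal because `G` acts on `N` through an
  -- abelian group, and it contains `n`, so minimality gives `E = N`.
  let E : Subgroup G :=
    { carrier := {x | x ∈ N ∧ x ^ i = a * x * a⁻¹}
      one_mem' := ⟨one_mem _, by simp⟩
      mul_mem' := fun {x y} hx hy => ⟨mul_mem hx.1 hy.1, by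
        rw [(show Commute x y from hcomm x hx.1 y hy.1).mul_zpow, hx.2, hy.2]; group⟩
      inv_mem' := fun {x} hx => ⟨inv_mem hx.1, by rw [inv_zpow, hx.2]; group⟩ }
  have hE : E.Normal := by
    refine ⟨fun x hx g => ⟨Normal.conj_mem inferInstance x hx.1 g, ?_⟩⟩
    have h1 := mem_centralizer_iff.1 (hcen g⁻¹ a⁻¹) x hx.1
    rw [conj_zpow, hx.2]
    have h2 : x * (g⁻¹ * a⁻¹ * g * a) = g⁻¹ * a⁻¹ * g * a * x := by
      simpa [commutatorElement_def] using h1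
    calc g * (a * x * a⁻¹) * g⁻¹
        = a * g * (g⁻¹ * a⁻¹ * g * a * x) * (g⁻¹ * a⁻¹ * g * a)⁻¹ * g⁻¹ * a⁻¹ := by group
      _ = a * (g * x * g⁻¹) * a⁻¹ := by rw [← h2]; group
  have hEN : E = N := hmin E hE (fun x hx => hx.1) fun hb => hn1 (by
    have : n ∈ E := ⟨hn.2, hi⟩
    rwa [hb, mem_bot] at this)
  obtain ⟨j, rfl⟩ := mem_zpowers_iff.1 hx
  have hmE : m ∈ E := hEN ▸ hm
  rw [← conj_zpow, ← hmE.2]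
  exact zpow_mem (zpow_mem_zpowers m i) j

theorem Subgroup.zpowers_normal_of_minimal_normal [Finite G] {A B C : Subgroup G}
    [Group.IsNilpotent ↥N] (hne : N ≠ ⊥)
    (hmin : ∀ M : Subgroup G, M.Normal → M ≤ N → M ≠ ⊥ → M = N)
    (hA : IsSupersoluble ↥A) (hB : IsSupersoluble ↥B) (hC : IsSupersoluble ↥C)
    (hNA : N ≤ A) (hNB : N ≤ B) (hNC : N ≤ C)
    (hAB : Nat.Coprime A.index B.index) (hBC : Nat.Coprime B.index C.index)
    (hAC : Nat.Coprime A.index C.index) {m : G} (hm : m ∈ N) : (zpowers m).Normal := by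
  obtain ⟨p, hp, hdvd, hpow⟩ := exists_prime_pow_eq_one_of_minimal_normal hne hmin
  have := Fact.mk hp
  have hcomm : ∀ x ∈ N, ∀ y ∈ N, x * y = y * x := fun x hx y hy =>
    mul_comm_of_minimal_normal hne hmin hx hy
  have hcen := commutator_le_centralizer_of_minimal_normal hdvd hpow hmin hA hB hC hNA hNB hNC
    hAB hBC hAC
  refine normalizer_eq_top_iff.1 (top_le_iff.1 ?_)
  rw [← sup_eq_top_of_coprime_index hAB]
  exact sup_le (mem_normalizer_zpowers_of_minimal_normal hcomm hne hmin hA hNA hcen hm)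
    (mem_normalizer_zpowers_of_minimal_normal hcomm hne hmin hB hNB hcen hm)

end Minimal

/-! ### A cyclic series for a nilpotent normal subgroup -/

theorem HasCyclicSeries.of_coprime_index {G : Type u} [Group G] [Finite G] {A B C : Subgroup G}
    (H : Subgroup G) [H.Normal] [Group.IsNilpotent ↥H]
    (hA : IsSupersoluble ↥A) (hB : IsSupersoluble ↥B) (hC : IsSupersoluble ↥C)
    (hHA : H ≤ A) (hHB : H ≤ B) (hHC : H ≤ C)
    (hAB : Nat.Coprime A.index B.index) (hBC : Nat.Coprime B.index C.index)
    (hAC : Nat.Coprime A.index C.index) : HasCyclicSeries ⊤ H := by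
  induction hn : Nat.card G using Nat.strong_induction_on generalizing G with
  | _ n ih =>
  subst hn
  by_cases hbot : H = ⊥
  · rw [hbot]
    exact .bot
  obtain ⟨N, hN⟩ := (Set.toFinite {N : Subgroup G | N.Normal ∧ N ≤ H ∧ N ≠ ⊥}).exists_minimal
    ⟨H, inferInstance, le_rfl, hbot⟩
  obtain ⟨hNn, hNH, hNb⟩ := hN.1
  have hmin : ∀ M : Subgroup G, M.Normal → M ≤ N → M ≠ ⊥ → M = N := fun M hM hMN hMb =>
    le_antisymm hMN (hN.2 (y := M) ⟨hM, hMN.trans hNH, hMb⟩ hMN)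
  have hNnil : Group.IsNilpotent ↥N := by
    have := Group.IsNilpotent.of_subgroupOf (F := H) (K := N)
    rw [subgroupOf_eq_top.2 hNH] at this
    exact Group.isNilpotent_top.1 this
  obtain ⟨z, hz⟩ := ne_bot_iff_exists_ne_one.1 hNb
  have hzn : (Subgroup.zpowers (z : G)).Normal := zpowers_normal_of_minimal_normal hNb hmin hA hB hC
    (hNH.trans hHA) (hNH.trans hHB) (hNH.trans hHC) hAB hBC hAC z.2
  set f := QuotientGroup.mk' (Subgroup.zpowers (z : G)) with hf
  have hsurj : Function.Surjective f := QuotientGroup.mk'_surjective _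
  have hker : f.ker = Subgroup.zpowers (z : G) := QuotientGroup.ker_mk' _
  have := Normal.map ‹H.Normal› f hsurj
  have := Group.IsNilpotent.map_subgroup (F := H) f
  have hmap := ih _ (card_quotient_lt (by simpa using fun h => hz (Subtype.ext h))) (H.map f)
    (hA.map f) (hB.map f) (hC.map f) (Subgroup.map_mono hHA) (Subgroup.map_mono hHB)
    (Subgroup.map_mono hHC) (coprime_index_map hsurj hAB)
    (coprime_index_map hsurj hBC) (coprime_index_map hsurj hAC) rfl
  have := HasCyclicSeries.comap hsurj (by rw [hker]; exact HasCyclicSeries.zpowers (z : G)) hmap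
  rwa [comap_map_eq_self] at this
  rw [hker, Subgroup.zpowers_le]
  exact hNH z.2

/-! ### Nilpotency of the derived subgroup -/

section

variable {G : Type*} [Group G]

theorem Subgroup.commutator_commutator_le_of_rotate {H₁ H₂ H₃ N : Subgroup G} [N.Normal]
    (h1 : ⁅⁅H₂, H₃⁆, H₁⁆ ≤ N) (h2 : ⁅⁅H₃, H₁⁆, H₂⁆ ≤ N) : ⁅⁅H₁, H₂⁆, H₃⁆ ≤ N := by
  rw [← QuotientGroup.ker_mk' N, ← Subgroup.map_eq_bot_iff, map_commutator, map_commutator] at *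
  exact commutator_commutator_eq_bot_of_rotate h1 h2

/-- The iterated commutator `⁅…⁅⁅K, D⁆, D⁆, …, D⁆` with `n` copies of `D`. -/
def Subgroup.iteratedCommutator (K D : Subgroup G) : ℕ → Subgroup G
  | 0 => K
  | n + 1 => ⁅iteratedCommutator K D n, D⁆

variable {K D : Subgroup G}

instance Subgroup.iteratedCommutator_normal [K.Normal] [D.Normal] (n : ℕ) :
    (iteratedCommutator K D n).Normal := by
  induction n with
  | zero => exact ‹K.Normal›
  | succ n ih => exact commutator_normal _ _

theorem Subgroup.iteratedCommutator_mono {L : Subgroup G} (h : K ≤ L) (n : ℕ) :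
    iteratedCommutator K D n ≤ iteratedCommutator L D n := by
  induction n with
  | zero => exact h
  | succ n ih => exact commutator_mono ih le_rfl

theorem Subgroup.iteratedCommutator_add (m n : ℕ) :
    iteratedCommutator K D (m + n) = iteratedCommutator (iteratedCommutator K D m) D n := by
  induction n with
  | zero => rfl
  | succ n ih => exact congrArg (⁅·, D⁆) ih

theorem Subgroup.lowerCentralSeries_eq_iteratedCommutator (n : ℕ) :
    D.lowerCentralSeries n = iteratedCommutator D D n := by
  induction n with
  | zero => rfl
  | succ n ih => rw [lowerCentralSeries_succ, ih]; rfl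

/-- Three subgroups lemma and induction. The extra `1` arises because index `j = 0` already stands
for one copy of `D`. -/
theorem Subgroup.commutator_iteratedCommutator_le [K.Normal] [D.Normal] (i j : ℕ) :
    ⁅iteratedCommutator K D i, iteratedCommutator D D j⁆ ≤ iteratedCommutator K D (i + j + 1) := by
  induction j generalizing i with
  | zero => exact le_rfl
  | succ j ih =>
    rw [commutator_comm]
    refine commutator_commutator_le_of_rotate (H₁ := iteratedCommutator D D j) (H₂ := D)
      (H₃ := iteratedCommutator K D i) ?_ ?_
    · rw [commutator_comm D]
      have := ih (i + 1)
      rwa [show i + 1 + j = i + (j + 1) by omega] at this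
    · exact commutator_mono (ih i) le_rfl

theorem HasCyclicSeries.exists_iteratedCommutator_eq_bot (h : HasCyclicSeries ⊤ K) :
    ∃ n, iteratedCommutator K (_root_.commutator G) n = ⊥ := by
  induction h with
  | bot => exact ⟨0, rfl⟩
  | step K g hK _ hn ih =>
    obtain ⟨n, hn'⟩ := ih
    have := hK.normal
    have hKg : (K ⊔ Subgroup.zpowers g).Normal := normalizer_eq_top_iff.1 (top_le_iff.1 hn)
    refine ⟨1 + n, le_bot_iff.1 ?_⟩
    rw [iteratedCommutator_add, ← hn']
    refine iteratedCommutator_mono ?_ n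
    change ⁅_, _⁆ ≤ K
    rw [commutator_comm, commutator_le]
    exact fun y hy m hm => commutatorElement_mem_of_mem_commutator hy hm

/-- If `n` commutators with G' kill `K`, then the `n`-th lower central term of G' centralises `K`,
so lies in `K`, and `n` more commutators kill it. -/
theorem HasCyclicSeries.isNilpotent_commutator (h : HasCyclicSeries ⊤ K)
    (hc : centralizer (K : Set G) ≤ K) : Group.IsNilpotent ↥(_root_.commutator G) := by
  have := h.normal
  obtain ⟨n, hn⟩ := h.exists_iteratedCommutator_eq_bot
  rw [isNilpotent_iff_lowerCentralSeries]
  have hle : iteratedCommutator (_root_.commutator G) (_root_.commutator G) n ≤ K := by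
    refine le_trans ?_ hc
    rw [← commutator_eq_bot_iff_le_centralizer, commutator_comm, ← le_bot_iff]
    refine (commutator_iteratedCommutator_le (K := K) 0 n).trans ?_
    rw [Nat.zero_add, iteratedCommutator, hn, commutator_bot_left]
  refine ⟨n + n, le_bot_iff.1 ?_⟩
  rw [lowerCentralSeries_eq_iteratedCommutator, iteratedCommutator_add, ← hn]
  exact iteratedCommutator_mono hle n

/-- A minimal counterexample `L` has L' < L by solubility, so L' ≤ F. As `L` centralises F, it has
class at most 2 and lies in F after all. -/
theorem centralizer_fittingSubgroup_le [Finite G] [Group.IsSolvable G] :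
    centralizer (fittingSubgroup G : Set G) ≤ fittingSubgroup G := by
  by_contra hC
  obtain ⟨L, hL⟩ := (Set.toFinite {L : Subgroup G | L.Normal ∧
    L ≤ centralizer (fittingSubgroup G : Set G) ∧ ¬ L ≤ fittingSubgroup G}).exists_minimal
    ⟨_, inferInstance, le_rfl, hC⟩
  obtain ⟨hLn, hLC, hLF⟩ := hL.1
  have hlt : ⁅L, L⁆ < L := Group.IsSolvable.commutator_lt_of_ne_bot fun h => hLF (h ▸ bot_le)
  have hle : ⁅L, L⁆ ≤ fittingSubgroup G := by
    by_contra hne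
    exact hlt.not_ge (hL.2 (y := ⁅L, L⁆) ⟨inferInstance, hlt.le.trans hLC, hne⟩ hlt.le)
  have : Group.IsNilpotent ↥L := by
    refine (isNilpotent_iff_lowerCentralSeries L).2 ⟨2, ?_⟩
    change ⁅⁅L, L⁆, L⁆ = ⊥
    rw [commutator_comm, commutator_eq_bot_iff_le_centralizer]
    exact hLC.trans (centralizer_le hle)
  exact hLF (le_fittingSubgroup L)

theorem IsSupersoluble.of_commutator_le [Finite G] (h : HasCyclicSeries ⊤ K)
    (hK : _root_.commutator G ≤ K) : IsSupersoluble G := by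
  obtain ⟨L, hL⟩ := (Set.toFinite {L : Subgroup G | HasCyclicSeries ⊤ L ∧ K ≤ L}).exists_maximal
    ⟨K, h, le_rfl⟩
  rw [isSupersoluble_iff]
  suffices L = ⊤ from this ▸ hL.1.1
  refine top_le_iff.1 fun g _ => ?_
  -- Every subgroup containing G' is normal, so any `g` may extend the series.
  have hn : (L ⊔ zpowers g).Normal :=
    Normal.of_commutator_le _ (hK.trans (hL.1.2.trans le_sup_left))
  exact hL.2 (y := L ⊔ zpowers g) ⟨hL.1.1.step_top g hn, hL.1.2.trans le_sup_left⟩ le_sup_left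
    (mem_sup_right (mem_zpowers g))

end

theorem theorem4p8 {G : Type*} [Group G] [Finite G] (A B C : Subgroup G)
    (hA : IsSupersoluble ↥A) (hB : IsSupersoluble ↥B) (hC : IsSupersoluble ↥C)
    (hAF : (fittingSubgroup G).IsRelSubnormal A)
    (hBF : (fittingSubgroup G).IsRelSubnormal B)
    (hCF : (fittingSubgroup G).IsRelSubnormal C)
    (hAB : Nat.Coprime A.index B.index)
    (hBC : Nat.Coprime B.index C.index)
    (hAC : Nat.Coprime A.index C.index) :
    IsSupersoluble G := by
  have hcop : ∀ {D E : Subgroup G}, Nat.Coprime D.index E.index →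
      Nat.Coprime (D ⊔ fittingSubgroup G).index (E ⊔ fittingSubgroup G).index := fun h =>
    Nat.Coprime.of_dvd (index_dvd_of_le le_sup_left) (index_dvd_of_le le_sup_left) h
  have := Group.isSolvable_of_coprime_index hA hB hC hAB hBC hAC
  have hF : HasCyclicSeries ⊤ (fittingSubgroup G) := HasCyclicSeries.of_coprime_index _
    (hA.sup_of_isRelSubnormal hAF) (hB.sup_of_isRelSubnormal hBF) (hC.sup_of_isRelSubnormal hCF)
    le_sup_right le_sup_right le_sup_right (hcop hAB) (hcop hBC) (hcop hAC)
  have := hF.isNilpotent_commutator centralizer_fittingSubgroup_le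
  exact IsSupersoluble.of_commutator_le hF (le_fittingSubgroup _)
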